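/- **Setting.** Let $\mathcal H$ be a complex Hilbert space with scalar product $(\cdot,\cdot)_{\mathcal H}$, and let $\mathcal X\subseteq\mathcal H$ be a dense subspace with a stronger norm (that is, a normed space with a continuous injection into $\mathcal H$ that has dense range). Let $\mathcal X^*$ be the space of bounded antilinear functionals on $\mathcal X$, with the pairing $\langle\cdot,\cdot\rangle$ and the operator norm, so that $\mathcal X\subseteq\mathcal H\subseteq\mathcal X^*$ via $\langle h,g\rangle=(h,g)_{\mathcal H}$. Let $H$ and $\widetilde H$ be self-adjoint operators in $\mathcal H$ with spectral measures $E,\widetilde E$, write $E(\lambda)=E((-\infty,\lambda))$, and let $P_{ac}(H)$, $\widetilde P_{ac}(\widetilde H)$ be the orthogonal projections onto their absolutely continuous subspaces. Let $J\subseteq\mathbb R$ be open, and assume: 1. $P_{ac}(H)E(J)=E(J)$ and $\widetilde P_{ac}(\widetilde H)\widetilde E(J)=\widetilde E(J)$. 2. For every $\lambda\in J$ there are bounded operators $A(\lambda),\widetilde A(\lambda):\mathcal X\to\mathcal X^*$ with $\langle A(\lambda)f,g\rangle=\frac{d}{d\lambda}(E(\lambda)P_{ac}(H)f,g)_{\mathcal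 H}$ for all $f,g\in\mathcal X$, and likewise for $\widetilde A$; and $\lambda\mapsto\langle A(\lambda)f,g\rangle$, $\lambda\mapsto\langle\widetilde A(\lambda)f,g\rangle$ are continuous on $J$. 3. The real functions $\sigma,\widetilde\sigma$ are continuous on $J$. There is a finite set $\mathcal N\subseteq J$ such that $a$ is real-valued, $C^1$ and injective on $J\setminus\mathcal N$ with $a'>0$ there; likewise for $\widetilde a$ with a finite set $\widetilde{\mathcal N}\subseteq J$. For $\phi\in\mathcal X$ put $u_J(t)=\sigma(H)e^{ita(H)}P_{ac}(H)E(J)\phi$ and $\widetilde u_J(t)=\widetilde\sigma(\widetilde H)e^{it\widetilde a(\widetilde H)}\widetilde P_{ac}(\widetilde H)\widetilde E(J)\phi$. All $L^2$ norms may take the value $+\infty$. If $P_{ac}(H)E(J)\phi$ is not in the domain of $\sigma(H)\chi_J(H)$, then the norms of $u_J$ below are understood as the supremum, over compact $K\subseteq J$, of the same norms of $u_K$; likewise for $\widetilde u_J$. **(i) Space-local comparison.** Let $\phi,\psi\in\mathcal X$ and suppose that for almost all $\lambda\in J$ $$\frac{|\sigma(\lambda)|}{|a'(\lambda)|^{1/2}}\,|\langle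 A(\lambda)\phi,\psi\rangle|\ \ge\ \frac{|\widetilde\sigma(\lambda)|}{|\widetilde a'(\lambda)|^{1/2}}\,|\langle\widetilde A(\lambda)\phi,\psi\rangle| .$$ Then $$\big\|(\sigma(H)e^{ita(H)}P_{ac}(H)E(J)\phi,\psi)_{\mathcal H}\big\|_{L^2(\mathbb R_t)}\ \ge\ \big\|(\widetilde\sigma(\widetilde H)e^{it\widetilde a(\widetilde H)}\widetilde P_{ac}(\widetilde H)\widetilde E(J)\phi,\psi)_{\mathcal H}\big\|_{L^2(\mathbb R_t)} .$$ **(ii) Space-global comparison.** Suppose in addition that $\mathcal X$ is a Hilbert space (complete, with a norm that satisfies the parallelogram law). Let $\phi\in\mathcal X$ and suppose that for almost all $\lambda\in J$ $$\frac{|\sigma(\lambda)|}{|a'(\lambda)|^{1/2}}\,\|A(\lambda)\phi\|_{\mathcal X^*}\ \ge\ \frac{|\widetilde\sigma(\lambda)|}{|\widetilde a'(\lambda)|^{1/2}}\,\|\widetilde A(\lambda)\phi\|_{\mathcal X^*} .$$ Then $$\big\|\sigma(H)e^{ita(H)}P_{ac}(H)E(J)\phi\big\|_{L^2(\mathbb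 R_t,\mathcal X^*)}\ \ge\ \big\|\widetilde\sigma(\widetilde H)e^{it\widetilde a(\widetilde H)}\widetilde P_{ac}(\widetilde H)\widetilde E(J)\phi\big\|_{L^2(\mathbb R_t,\mathcal X^*)} .$$ -/

import Mathlib

open MeasureTheory Filter Topology
open scoped ENNReal

noncomputable section

/-- A (Borel) spectral measure on `ℝ`: a strongly countably additive, multiplicative family of
orthogonal projections `E(B)` with `E(ℝ) = 1`. Values on non-measurable sets are irrelevant. -/
structure SpectralMeasure (𝓗 : Type*) [NormedAddCommGroup 𝓗] [InnerProductSpace ℂ 𝓗]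
    [CompleteSpace 𝓗] where
  proj : Set ℝ → 𝓗 →L[ℂ] 𝓗
  isStarProjection : ∀ B, MeasurableSet B → IsStarProjection (proj B)
  proj_univ : proj Set.univ = 1
  proj_inter : ∀ B C, MeasurableSet B → MeasurableSet C → proj (B ∩ C) = proj B * proj C
  hasSum_proj : ∀ B : ℕ → Set ℝ, (∀ n, MeasurableSet (B n)) →
    Pairwise (Function.onFun Disjoint B) →
    ∀ φ : 𝓗, HasSum (fun n => proj (B n) φ) (proj (⋃ n, B n) φ)

namespace SpectralMeasure

variable {𝓗 : Type*} [NormedAddCommGroup 𝓗] [InnerProductSpace ℂ 𝓗] [CompleteSpace 𝓗]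

theorem proj_empty_apply (E : SpectralMeasure 𝓗) (φ : 𝓗) : E.proj ∅ φ = 0 := by
  have h := E.hasSum_proj (fun _ => ∅) (fun _ => MeasurableSet.empty)
    (fun _ _ _ => by simp [Function.onFun]) φ
  have h' := h.summable.tendsto_atTop_zero
  exact tendsto_nhds_unique tendsto_const_nhds h'

theorem re_inner_proj (E : SpectralMeasure 𝓗) (φ : 𝓗) {B : Set ℝ} (hB : MeasurableSet B) :
    RCLike.re (inner ℂ φ (E.proj B φ)) = ‖E.proj B φ‖ ^ 2 := by
  have hp := E.isStarProjection B hB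
  have h1 : E.proj B (E.proj B φ) = E.proj B φ := by
    have := congrArg (fun T : 𝓗 →L[ℂ] 𝓗 => T φ) hp.isIdempotentElem.eq
    simpa using this
  have h2 : ContinuousLinearMap.adjoint (E.proj B) = E.proj B := hp.isSelfAdjoint
  rw [← h1, ← ContinuousLinearMap.adjoint_inner_left, h2, h1]
  exact inner_self_eq_norm_sq (𝕜 := ℂ) _

/-- The measure `μ_φ(B) = (E(B)φ, φ) = ‖E(B)φ‖²`. -/
def diag (E : SpectralMeasure 𝓗) (φ : 𝓗) : Measure ℝ :=
  Measure.ofMeasurable (fun B _ => ENNReal.ofReal (‖E.proj B φ‖ ^ 2))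
    (by simp [E.proj_empty_apply])
    (by
      intro B hB hd
      have h := ((E.hasSum_proj B hB hd φ).mapL (innerSL ℂ φ)).mapL Complex.reCLM
      have h2 : HasSum (fun n => ‖E.proj (B n) φ‖ ^ 2) (‖E.proj (⋃ n, B n) φ‖ ^ 2) := by
        rw [← E.re_inner_proj φ (MeasurableSet.iUnion hB)]
        refine h.congr_fun ?_
        intro n
        exact (E.re_inner_proj φ (hB n)).symm
      rw [← h2.tsum_eq]
      exact ENNReal.ofReal_tsum_of_nonneg (fun n => by positivity) h2.summable)

theorem diag_apply (E : SpectralMeasure 𝓗) (φ : 𝓗) {B : Set ℝ} (hB : MeasurableSet B) :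
    E.diag φ B = ENNReal.ofReal (‖E.proj B φ‖ ^ 2) :=
  Measure.ofMeasurable_apply B hB

/-- `φ` lies in the domain of the operator `f(H) = ∫ f dE`. -/
def InDomain (E : SpectralMeasure 𝓗) (f : ℝ → ℂ) (φ : 𝓗) : Prop :=
  MemLp f 2 (E.diag φ)

/-- `∫ s dE φ` for a simple function `s`. -/
def simpleIntegral (E : SpectralMeasure 𝓗) (s : SimpleFunc ℝ ℂ) (φ : 𝓗) : 𝓗 :=
  ∑ c ∈ s.range, c • E.proj (s ⁻¹' {c}) φ

/-- The functional calculus `f(H)φ = ∫ f dE φ`: the limit of `∫ s dE φ` as the simple function `s`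
tends to `f` in `L²(μ_φ)`. It is meaningful whenever `E.InDomain f φ`. -/
def integral (E : SpectralMeasure 𝓗) (f : ℝ → ℂ) (φ : 𝓗) : 𝓗 :=
  haveI : Nonempty 𝓗 := ⟨0⟩
  limUnder (comap (fun s : SimpleFunc ℝ ℂ => eLpNorm (fun x => f x - s x) 2 (E.diag φ)) (𝓝 0))
    (fun s => E.simpleIntegral s φ)

/-- `E` is the spectral measure of the operator `H`, that is, `H = ∫ λ dE(λ)`, domains included. -/
structure IsSpectralMeasureOf (E : SpectralMeasure 𝓗) (H : 𝓗 →ₗ.[ℂ] 𝓗) : Prop where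
  mem_domain_iff : ∀ φ : 𝓗, φ ∈ H.domain ↔ E.InDomain (fun x => (x : ℂ)) φ
  apply_eq : ∀ φ : H.domain, H φ = E.integral (fun x => (x : ℂ)) (φ : 𝓗)

theorem ac_iff (E : SpectralMeasure 𝓗) (φ : 𝓗) :
    E.diag φ ≪ volume ↔ ∀ B, MeasurableSet B → volume B = 0 → E.proj B φ = 0 := by
  constructor
  · intro h B hB h0
    have := h h0
    rw [E.diag_apply φ hB, ENNReal.ofReal_eq_zero] at this
    have h3 : ‖E.proj B φ‖ ^ 2 = 0 := le_antisymm this (by positivity)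
    simpa using h3
  · intro h
    refine Measure.AbsolutelyContinuous.mk fun B hB h0 => ?_
    rw [E.diag_apply φ hB, h B hB h0]
    simp

/-- The absolutely continuous subspace: all `φ` with `μ_φ` absolutely continuous with respect to
Lebesgue measure. -/
def acSubspace (E : SpectralMeasure 𝓗) : Submodule ℂ 𝓗 where
  carrier := {φ | E.diag φ ≪ volume}
  zero_mem' := (E.ac_iff 0).2 fun B _ _ => map_zero _
  add_mem' := by
    intro φ ψ hφ hψ
    refine (E.ac_iff _).2 fun B hB h0 => ?_
    rw [map_add, (E.ac_iff φ).1 hφ B hB h0, (E.ac_iff ψ).1 hψ B hB h0, add_zero]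
  smul_mem' := by
    intro c φ hφ
    refine (E.ac_iff _).2 fun B hB h0 => ?_
    rw [map_smul, (E.ac_iff φ).1 hφ B hB h0, smul_zero]

theorem isClosed_acSubspace (E : SpectralMeasure 𝓗) : IsClosed (E.acSubspace : Set 𝓗) := by
  have h : (E.acSubspace : Set 𝓗) =
      ⋂ B : Set ℝ, ⋂ _ : MeasurableSet B, ⋂ _ : volume B = 0, {φ | E.proj B φ = 0} := by
    ext φ
    simp only [Set.mem_iInter]
    exact E.ac_iff φ
  rw [h]
  exact isClosed_iInter fun B => isClosed_iInter fun _ => isClosed_iInter fun _ =>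
    isClosed_eq (E.proj B).continuous continuous_const

instance (E : SpectralMeasure 𝓗) : E.acSubspace.HasOrthogonalProjection :=
  haveI : CompleteSpace E.acSubspace := E.isClosed_acSubspace.completeSpace_coe
  inferInstance

/-- `P_ac(H)`: the orthogonal projection onto the absolutely continuous subspace. -/
def pac (E : SpectralMeasure 𝓗) : 𝓗 →L[ℂ] 𝓗 :=
  E.acSubspace.starProjection

/-- `σ(H) e^{i t a(H)} P_ac(H) E(S) φ`. -/
def evolution (E : SpectralMeasure 𝓗) (σ a : ℝ → ℝ) (S : Set ℝ) (φ : 𝓗) (t : ℝ) : 𝓗 :=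
  E.integral (S.indicator fun x => (σ x : ℂ) * Complex.exp (Complex.I * t * a x))
    (E.pac (E.proj S φ))

open Classical in
/-- The norm `‖Φ(σ(H) e^{i t a(H)} P_ac(H) E(J) φ)‖_{L²(ℝ_t, Y)}`, with value `∞` allowed.

If `P_ac(H) E(J) φ` is in the domain of `σ(H)` this is literally that norm. If not, the evolution is
not defined as a vector, and it is understood through energy cut-offs: the norm is the
supremum over compact `K ⊆ J` of the norms with `J` replaced by `K`. -/
def evolutionNorm {Y : Type*} [NormedAddCommGroup Y] (E : SpectralMeasure 𝓗) (σ a : ℝ → ℝ)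
    (J : Set ℝ) (Φ : 𝓗 → Y) (φ : 𝓗) : ℝ≥0∞ :=
  if E.InDomain (J.indicator fun x => (σ x : ℂ)) (E.pac (E.proj J φ)) then
    eLpNorm (fun t : ℝ => Φ (E.evolution σ a J φ t)) 2 volume
  else
    ⨆ (K : Set ℝ) (_ : IsCompact K) (_ : K ⊆ J),
      eLpNorm (fun t : ℝ => Φ (E.evolution σ a K φ t)) 2 volume

end SpectralMeasure

/-- The embedding `𝓗 ⊆ 𝒳*` induced by `ι : 𝒳 → 𝓗`, where `𝒳*` is the space of bounded antilinear
functionals: `⟨h, g⟩ = (h, ι g)`. The scalar product `(u, v)_𝓗`, linear in `u`, is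
`inner ℂ v u`. -/
def dualEmbedding {𝓗 X : Type*} [NormedAddCommGroup 𝓗] [InnerProductSpace ℂ 𝓗]
    [NormedAddCommGroup X] [NormedSpace ℂ X] (ι : X →L[ℂ] 𝓗) (h : 𝓗) : X →L⋆[ℂ] ℂ :=
  ((innerSL ℂ).flip h).comp ι

theorem dualEmbedding_apply {𝓗 X : Type*} [NormedAddCommGroup 𝓗] [InnerProductSpace ℂ 𝓗]
    [NormedAddCommGroup X] [NormedSpace ℂ X] (ι : X →L[ℂ] 𝓗) (h : 𝓗) (g : X) :
    dualEmbedding ι h g = inner ℂ (ι g) h := rfl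

/-- On the open set `J`, the spectrum is purely absolutely continuous, `P_ac(H) E(J) = E(J)`, and
`A(λ) = d/dλ (E(-∞, λ) P_ac(H)) : 𝒳 → 𝒳*` exists weakly and is weakly continuous. -/
structure IsSpectralDensity {𝓗 X : Type*} [NormedAddCommGroup 𝓗] [InnerProductSpace ℂ 𝓗]
    [CompleteSpace 𝓗] [NormedAddCommGroup X] [NormedSpace ℂ X]
    (E : SpectralMeasure 𝓗) (ι : X →L[ℂ] 𝓗) (J : Set ℝ)
    (A : ℝ → X →L[ℂ] (X →L⋆[ℂ] ℂ)) : Prop where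
  pac_proj : E.pac ∘L E.proj J = E.proj J
  hasDerivAt : ∀ f g : X, ∀ l ∈ J,
    HasDerivAt (fun l : ℝ => inner ℂ (ι g) (E.proj (Set.Iio l) (E.pac (ι f)))) (A l f g) l
  weakly_continuous : ∀ f g : X, ContinuousOn (fun l => A l f g) J

/-- `σ` is continuous on `J`, and off a finite subset of `J` the function `a` is `C¹` with positive
derivative and is injective (so that `η = a(λ)` is a change of variables). -/
def IsAdmissible (J : Set ℝ) (σ a : ℝ → ℝ) : Prop :=
  ContinuousOn σ J ∧ ∃ N : Set ℝ, N.Finite ∧ N ⊆ J ∧ ContDiffOn ℝ 1 a (J \ N) ∧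
    (∀ l ∈ J \ N, 0 < deriv a l) ∧ Set.InjOn a (J \ N)

end

/-! ### Plancherel's theorem for integrable functions. -/

section Plancherel

open FourierTransform SchwartzMap
open scoped ContDiff

/-! Each norm is computed exactly. On `J` the measure `(E(·)φ, ψ)` has density `⟨A(λ)φ, ψ⟩`, so
`(u_J(t), ψ) = ∫_J e^{ita(λ)} σ(λ) ⟨A(λ)φ, ψ⟩ dλ` when the domain condition holds. Substituting `η =
a(λ)` turns this into a Fourier integral, and Plancherel in `t` gives the squared norm `2π ∫_J σ² /
a' · |⟨Aφ, ψ⟩|² dλ` (`lintegral_inner_evolution_sq`). Outside the domain, monotone convergence over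
compact sets gives the same formula (`evolutionNorm_sq_eq`). The local comparison then integrates
the squared hypothesis.

For the global comparison, the local identity is summed over an orthonormal basis of `X`. Parseval
replaces `|⟨Aφ, ψ⟩|` by `‖Aφ‖`; only countably many basis vectors contribute
(`exists_countable_parseval`).

The density formula needs care because `A` is only a weak derivative. Positivity and Cauchy–Schwarz
for `⟨A(λ)f, g⟩` come from difference quotients. They bound `θ ↦ ∫ θ ⟨Af, g⟩` on `L²(μ_f)`, which
carries the formula from projections to the functional calculus. -/

theorem ae_eq_of_integral_schwartz_smul_eq {f g : ℝ → ℂ} (hf : LocallyIntegrable f)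
    (hg : LocallyIntegrable g)
    (h : ∀ φ : 𝓢(ℝ, ℂ), ∫ x, φ x • f x = ∫ x, φ x • g x) : f =ᵐ[volume] g := by
  refine ae_eq_of_integral_contDiff_smul_eq hf hg fun θ hθ hθc => ?_
  have h1 : HasCompactSupport (Complex.ofRealCLM ∘ θ) := hθc.comp_left rfl
  have h2 : ContDiff ℝ ∞ (Complex.ofRealCLM ∘ θ) := by fun_prop
  simpa using h (h1.toSchwartzMap h2)

theorem integral_schwartz_smul_fourier {G : ℝ → ℂ} (hG : Integrable G) (φ : 𝓢(ℝ, ℂ)) :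
    ∫ x, φ x • 𝓕 G x = ∫ x, (𝓕 φ) x • G x := by
  have := VectorFourier.integral_fourierIntegral_smul_eq_flip (L := innerₗ ℝ)
    (e := Real.fourierChar) (μ := volume) (ν := volume)
    Real.continuous_fourierChar continuous_inner φ.integrable hG
  rw [SchwartzMap.fourier_coe]
  simp only [flip_innerₗ] at this
  exact this.symm

theorem continuous_fourier_of_integrable {G : ℝ → ℂ} (hG : Integrable G) : Continuous (𝓕 G) :=
  VectorFourier.fourierIntegral_continuous Real.continuous_fourierChar
    (L := innerₗ ℝ) continuous_inner hG

/-- Both transforms define the same tempered distribution, because both move onto the test function.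
-/
theorem fourier_ae_eq_Lp_fourier {G : ℝ → ℂ} (hG : Integrable G) (h2 : MemLp G 2) :
    𝓕 G =ᵐ[volume] (𝓕 (h2.toLp G) : Lp ℂ 2 (volume : Measure ℝ)) := by
  refine ae_eq_of_integral_schwartz_smul_eq
    (continuous_fourier_of_integrable hG).locallyIntegrable
    ((Lp.memLp _).locallyIntegrable (by norm_num)) fun φ => ?_
  rw [integral_schwartz_smul_fourier hG, ← Lp.toTemperedDistribution_apply,
    ← Lp.fourier_toTemperedDistribution_eq, TemperedDistribution.fourier_apply,
    Lp.toTemperedDistribution_apply]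
  refine integral_congr_ae ?_
  filter_upwards [h2.coeFn_toLp] with x hx
  rw [hx]

/-- The inverse `L²` transform of `𝓕 G` agrees with `G` as a distribution. This settles the infinite
case of Plancherel. -/
theorem memLp_two_of_fourier {G : ℝ → ℂ} (hG : Integrable G) (h2 : MemLp (𝓕 G) 2) :
    MemLp G 2 := by
  have : G =ᵐ[volume] (𝓕⁻ (h2.toLp (𝓕 G)) : Lp ℂ 2 (volume : Measure ℝ)) := by
    refine ae_eq_of_integral_schwartz_smul_eq hG.locallyIntegrable
      ((Lp.memLp _).locallyIntegrable (by norm_num)) fun φ => ?_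
    rw [← Lp.toTemperedDistribution_apply,
      ← Lp.fourierInv_toTemperedDistribution_eq, TemperedDistribution.fourierInv_apply,
      Lp.toTemperedDistribution_apply]
    have h3 := integral_schwartz_smul_fourier hG (𝓕⁻ φ)
    rw [FourierTransform.fourier_fourierInv_eq] at h3
    rw [← h3]
    refine integral_congr_ae ?_
    filter_upwards [h2.coeFn_toLp] with x hx
    rw [hx]
  exact (memLp_congr_ae this).2 (Lp.memLp _)

/-- Plancherel's theorem for an integrable function, both sides possibly infinite. -/
theorem eLpNorm_fourier_of_integrable {G : ℝ → ℂ} (hG : Integrable G) :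
    eLpNorm (𝓕 G) 2 volume = eLpNorm G 2 volume := by
  by_cases h2 : MemLp G 2
  · rw [eLpNorm_congr_ae (fourier_ae_eq_Lp_fourier hG h2), ← Lp.enorm_def, ← ofReal_norm,
      Lp.norm_fourier_eq, ofReal_norm, Lp.enorm_def, eLpNorm_congr_ae h2.coeFn_toLp]
  · have h3 : ¬ MemLp (𝓕 G) 2 := fun h => h2 (memLp_two_of_fourier hG h)
    have h4 : eLpNorm G 2 volume = ⊤ := by
      by_contra h
      exact h2 ⟨hG.1, lt_top_iff_ne_top.2 h⟩
    have h5 : eLpNorm (𝓕 G) 2 volume = ⊤ := by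
      by_contra h
      exact h3 ⟨(continuous_fourier_of_integrable hG).aestronglyMeasurable,
        lt_top_iff_ne_top.2 h⟩
    rw [h4, h5]

theorem eLpNorm_two_sq {α F : Type*} [MeasurableSpace α] [NormedAddCommGroup F]
    (μ : Measure α) (f : α → F) :
    eLpNorm f 2 μ ^ 2 = ∫⁻ x, ‖f x‖ₑ ^ 2 ∂μ := by
  have := eLpNorm_nnreal_pow_eq_lintegral (μ := μ) (f := f) (p := 2) (by norm_num)
  simpa using this

/-- Plancherel's theorem with the kernel `exp (i t x)`. -/
theorem lintegral_integral_exp_mul_sq {G : ℝ → ℂ} (hG : Integrable G) :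
    ∫⁻ t : ℝ, ‖∫ x : ℝ, Complex.exp (Complex.I * t * x) * G x‖ₑ ^ 2 =
      ENNReal.ofReal (2 * Real.pi) * ∫⁻ x, ‖G x‖ₑ ^ 2 := by
  -- The kernel of `𝓕` is `exp(-2πi x ξ)`, so `ξ = -t / (2π)`; rescaling `t` produces the factor
  -- `2π`.
  have h1 : ∀ t : ℝ, ∫ x : ℝ, Complex.exp (Complex.I * t * x) * G x =
      𝓕 G ((-(2 * Real.pi)⁻¹) * t) := by
    intro t
    rw [Real.fourier_real_eq_integral_exp_smul]
    refine integral_congr_ae (Eventually.of_forall fun x => ?_)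
    simp only [smul_eq_mul]
    congr 2
    push_cast
    have : (Real.pi : ℂ) ≠ 0 := by exact_mod_cast Real.pi_ne_zero
    field_simp
  simp_rw [h1]
  have hm : Measurable fun t : ℝ => ‖𝓕 G t‖ₑ ^ 2 := by
    have := (continuous_fourier_of_integrable hG).measurable
    fun_prop
  have hc : (-(2 * Real.pi)⁻¹ : ℝ) ≠ 0 := by
    have := Real.pi_pos
    simp [this.ne']
  have h2 := Real.map_volume_mul_left hc
  have h3 := lintegral_map (μ := volume) hm (measurable_const_mul (-(2 * Real.pi)⁻¹ : ℝ))
  rw [← h3, h2, lintegral_smul_measure, ← eLpNorm_two_sq, ← eLpNorm_two_sq,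
    eLpNorm_fourier_of_integrable hG, smul_eq_mul]
  congr 2
  rw [inv_neg, inv_inv, abs_neg, abs_of_pos (by positivity)]

end Plancherel

/-! ### The functional calculus of a spectral measure. -/

namespace SpectralMeasure

variable {𝓗 : Type*} [NormedAddCommGroup 𝓗] [InnerProductSpace ℂ 𝓗] [CompleteSpace 𝓗]

theorem proj_union_apply (E : SpectralMeasure 𝓗) {B C : Set ℝ} (hB : MeasurableSet B)
    (hC : MeasurableSet C) (hd : Disjoint B C) (φ : 𝓗) :
    E.proj (B ∪ C) φ = E.proj B φ + E.proj C φ := by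
  have hm : ∀ b : Bool, MeasurableSet (bif b then B else C) := by
    rintro (_ | _) <;> simpa
  -- The pair is padded with empty sets to a sequence, so that countable additivity applies.
  have h := E.hasSum_proj (fun n => ⋃ b ∈ Encodable.decode₂ Bool n, bif b then B else C)
    (fun _ => Encodable.iUnion_decode₂_cases (C := MeasurableSet) MeasurableSet.empty hm)
    (Encodable.iUnion_decode₂_disjoint_on (by simpa [pairwise_on_bool] using hd)) φ
  rw [Encodable.iUnion_decode₂] at h
  have h0 : E.proj ∅ φ = 0 := E.proj_empty_apply φ
  have h1 := h.tsum_eq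
  rw [tsum_iUnion_decode₂ (m := fun s => E.proj s φ) h0, tsum_bool] at h1
  rw [Set.union_eq_iUnion, ← h1, add_comm]
  rfl

theorem proj_proj_apply (E : SpectralMeasure 𝓗) {B C : Set ℝ} (hB : MeasurableSet B)
    (hC : MeasurableSet C) (φ : 𝓗) : E.proj B (E.proj C φ) = E.proj (B ∩ C) φ := by
  rw [E.proj_inter B C hB hC]
  rfl

theorem inner_proj_left (E : SpectralMeasure 𝓗) {B : Set ℝ} (hB : MeasurableSet B) (φ ψ : 𝓗) :
    inner ℂ (E.proj B φ) ψ = inner ℂ φ (E.proj B ψ) := by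
  have h : ContinuousLinearMap.adjoint (E.proj B) = E.proj B :=
    (E.isStarProjection B hB).isSelfAdjoint
  conv_rhs => rw [← h, ContinuousLinearMap.adjoint_inner_right]

theorem inner_proj_proj (E : SpectralMeasure 𝓗) {B C : Set ℝ} (hB : MeasurableSet B)
    (hC : MeasurableSet C) (φ ψ : 𝓗) :
    inner ℂ (E.proj B φ) (E.proj C ψ) = inner ℂ φ (E.proj (B ∩ C) ψ) := by
  rw [E.inner_proj_left hB, E.proj_proj_apply hB hC]

theorem diag_proj (E : SpectralMeasure 𝓗) {S : Set ℝ} (hS : MeasurableSet S) (φ : 𝓗) :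
    E.diag (E.proj S φ) = (E.diag φ).restrict S := by
  ext B hB
  rw [Measure.restrict_apply hB, E.diag_apply _ hB, E.diag_apply _ (hB.inter hS),
    E.proj_proj_apply hB hS]

instance isFiniteMeasure_diag (E : SpectralMeasure 𝓗) (φ : 𝓗) : IsFiniteMeasure (E.diag φ) :=
  ⟨by rw [E.diag_apply φ MeasurableSet.univ]; exact ENNReal.ofReal_lt_top⟩

/-- Pythagoras: distinct fibres of `s` are disjoint, so their projections have orthogonal ranges. -/
theorem enorm_simpleIntegral_sq (E : SpectralMeasure 𝓗) (s : SimpleFunc ℝ ℂ) (φ : 𝓗) :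
    ‖E.simpleIntegral s φ‖ₑ ^ 2 = ∫⁻ x, ‖s x‖ₑ ^ 2 ∂(E.diag φ) := by
  have h1 : ‖E.simpleIntegral s φ‖ ^ 2 =
      ∑ c ∈ s.range, ‖c‖ ^ 2 * ‖E.proj (s ⁻¹' {c}) φ‖ ^ 2 := by
    rw [← inner_self_eq_norm_sq (𝕜 := ℂ), simpleIntegral, sum_inner, map_sum]
    refine Finset.sum_congr rfl fun c hc => ?_
    rw [inner_sum, map_sum, Finset.sum_eq_single_of_mem c hc, inner_self_eq_norm_sq, norm_smul,
      mul_pow]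
    intro d _ hdc
    have : s ⁻¹' {c} ∩ s ⁻¹' {d} = ∅ := by
      rw [← Set.preimage_inter, Set.singleton_inter_eq_empty.2 (by simpa using hdc.symm),
        Set.preimage_empty]
    rw [inner_smul_left, inner_smul_right, E.inner_proj_proj (s.measurableSet_fiber c)
      (s.measurableSet_fiber d), this, E.proj_empty_apply]
    simp
  have h2 : ∫⁻ x, ‖s x‖ₑ ^ 2 ∂(E.diag φ) = (s.map fun c => ‖c‖ₑ ^ 2).lintegral (E.diag φ) := by
    rw [← SimpleFunc.lintegral_eq_lintegral]
    rfl
  rw [h2, SimpleFunc.map_lintegral, ← ofReal_norm, ← ENNReal.ofReal_pow (norm_nonneg _), h1,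
    ENNReal.ofReal_sum_of_nonneg fun _ _ => by positivity]
  refine Finset.sum_congr rfl fun c _ => ?_
  rw [ENNReal.ofReal_mul (by positivity), E.diag_apply _ (s.measurableSet_fiber c),
    ENNReal.ofReal_pow (norm_nonneg _), ofReal_norm]

theorem enorm_simpleIntegral (E : SpectralMeasure 𝓗) (s : SimpleFunc ℝ ℂ) (φ : 𝓗) :
    ‖E.simpleIntegral s φ‖ₑ = eLpNorm s 2 (E.diag φ) := by
  have h := E.enorm_simpleIntegral_sq s φ
  rw [← eLpNorm_two_sq] at h
  exact (ENNReal.pow_right_strictMono two_ne_zero).injective h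

theorem simpleIntegral_sub (E : SpectralMeasure 𝓗) (s t : SimpleFunc ℝ ℂ) (φ : 𝓗) :
    E.simpleIntegral (s - t) φ = E.simpleIntegral s φ - E.simpleIntegral t φ := by
  -- With this `T`, `simpleIntegral` unfolds to `SimpleFunc.setToSimpleFunc`, whose subtraction
  -- lemma handles the common refinement of fibres.
  let T : Set ℝ → ℂ →L[ℝ] 𝓗 := fun B =>
    (ContinuousLinearMap.toSpanSingleton ℂ (E.proj B φ)).restrictScalars ℝ
  have hT : FinMeasAdditive (E.diag φ) T := by
    intro B C hB hC _ _ hd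
    ext1 c
    simp [T, E.proj_union_apply hB hC hd, smul_add]
  exact SimpleFunc.setToSimpleFunc_sub T hT (SimpleFunc.integrable_of_isFiniteMeasure s)
    (SimpleFunc.integrable_of_isFiniteMeasure t)

/-- Simple functions approaching `f` in `L²(μ_φ)`. -/
noncomputable abbrev simpleApprox (E : SpectralMeasure 𝓗) (f : ℝ → ℂ) (φ : 𝓗) : Filter (SimpleFunc ℝ ℂ) :=
  comap (fun s : SimpleFunc ℝ ℂ => eLpNorm (fun x => f x - s x) 2 (E.diag φ)) (𝓝 0)

theorem simpleApprox_neBot {E : SpectralMeasure 𝓗} {f : ℝ → ℂ} {φ : 𝓗} (hf : E.InDomain f φ) :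
    (E.simpleApprox f φ).NeBot := by
  refine comap_neBot_iff.2 fun t ht => ?_
  obtain ⟨ε, hε, hεt⟩ := ENNReal.nhds_zero_basis.mem_iff.1 ht
  obtain ⟨s, hs, -⟩ := hf.exists_simpleFunc_eLpNorm_sub_lt (by norm_num) hε.ne'
  exact ⟨s, hεt hs⟩

/-- By the isometry for simple functions the image filter is Cauchy, so completeness makes the
`limUnder` in `integral` a genuine limit. -/
theorem tendsto_simpleIntegral {E : SpectralMeasure 𝓗} {f : ℝ → ℂ} {φ : 𝓗}
    (hf : E.InDomain f φ) :
    Tendsto (fun s => E.simpleIntegral s φ) (E.simpleApprox f φ) (𝓝 (E.integral f φ)) := by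
  have := simpleApprox_neBot hf
  refine tendsto_nhds_limUnder (cauchy_map_iff_exists_tendsto.1 ?_)
  refine EMetric.cauchy_iff.2 ⟨(this.map _).ne, fun ε hε => ?_⟩
  have hε2 : 0 < ε / 2 := ENNReal.half_pos hε.ne'
  refine ⟨_, image_mem_map (preimage_mem_comap (Iio_mem_nhds hε2)), ?_⟩
  rintro _ ⟨s, hs, rfl⟩ _ ⟨t, ht, rfl⟩
  rw [edist_eq_enorm_sub, ← E.simpleIntegral_sub, E.enorm_simpleIntegral]
  have h1 : (⇑(s - t) : ℝ → ℂ) = (fun x => f x - t x) - fun x => f x - s x := by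
    ext x
    simp
  rw [h1]
  refine (eLpNorm_sub_le (hf.1.sub t.aestronglyMeasurable) (hf.1.sub s.aestronglyMeasurable)
    (by norm_num)).trans_lt ?_
  rw [← ENNReal.add_halves ε]
  exact ENNReal.add_lt_add ht hs

theorem integral_simpleFunc_mul {ν : Measure ℝ} {k : ℝ → ℂ} (hk : Integrable k ν)
    (s : SimpleFunc ℝ ℂ) :
    Integrable (fun x => s x * k x) ν ∧
      ∫ x, s x * k x ∂ν = ∑ c ∈ s.range, c * ∫ x in s ⁻¹' {c}, k x ∂ν := by
  have h1 : (fun x => s x * k x) =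
      fun x => ∑ c ∈ s.range, (s ⁻¹' {c}).indicator (fun x => c * k x) x := by
    ext x
    rw [Finset.sum_eq_single_of_mem (s x) (s.mem_range_self x)]
    · simp
    · intro c _ hc
      exact Set.indicator_of_notMem (by simpa using hc.symm) _
  have h2 : ∀ c ∈ s.range, Integrable ((s ⁻¹' {c}).indicator fun x => c * k x) ν :=
    fun c _ => (hk.const_mul c).indicator (s.measurableSet_fiber c)
  rw [h1]
  refine ⟨integrable_finsetSum _ h2, ?_⟩
  rw [integral_finsetSum _ h2]
  refine Finset.sum_congr rfl fun c _ => ?_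
  rw [integral_indicator (s.measurableSet_fiber c), integral_const_mul]

/-- If `(E(B)φ, w) = ∫_B k dν` and `k` defines a bounded functional on `L²(μ_φ)`, then
`(f(H)φ, w) = ∫ f k dν`. -/
theorem inner_integral {E : SpectralMeasure 𝓗} {φ w : 𝓗} {ν : Measure ℝ} {k : ℝ → ℂ}
    (hk : Integrable k ν)
    (hE : ∀ B, MeasurableSet B → inner ℂ w (E.proj B φ) = ∫ x in B, k x ∂ν)
    {C : ℝ≥0∞} (hC : C ≠ ∞)
    (hb : ∀ g : ℝ → ℂ, Measurable g → ∫⁻ x, ‖g x * k x‖ₑ ∂ν ≤ C * eLpNorm g 2 (E.diag φ))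
    {f : ℝ → ℂ} (hfm : Measurable f) (hf : E.InDomain f φ) :
    Integrable (fun x => f x * k x) ν ∧
      inner ℂ w (E.integral f φ) = ∫ x, f x * k x ∂ν := by
  have hfi : Integrable (fun x => f x * k x) ν :=
    ⟨hfm.aestronglyMeasurable.mul hk.1,
      (hb f hfm).trans_lt (ENNReal.mul_lt_top hC.lt_top hf.2)⟩
  refine ⟨hfi, ?_⟩
  have := simpleApprox_neBot hf
  have h1 : Tendsto (fun s => inner ℂ w (E.simpleIntegral s φ)) (E.simpleApprox f φ)
      (𝓝 (inner ℂ w (E.integral f φ))) :=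
    tendsto_const_nhds.inner (tendsto_simpleIntegral hf)
  -- The bound `hb`, applied to `f - s`, turns `L²(μ_φ)` convergence into `L¹(ν)` convergence of `s
  -- * k`.
  have h2 : Tendsto (fun s : SimpleFunc ℝ ℂ => ∫ x, s x * k x ∂ν) (E.simpleApprox f φ)
      (𝓝 (∫ x, f x * k x ∂ν)) := by
    refine tendsto_integral_of_L1 _ hfi.1
      (Eventually.of_forall fun s => (integral_simpleFunc_mul hk s).1) ?_
    have h3 : Tendsto (fun s : SimpleFunc ℝ ℂ =>
        C * eLpNorm (fun x => f x - s x) 2 (E.diag φ)) (E.simpleApprox f φ) (𝓝 0) := by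
      simpa using ENNReal.Tendsto.const_mul (tendsto_comap (x := 𝓝 (0 : ℝ≥0∞))
        (f := fun s : SimpleFunc ℝ ℂ => eLpNorm (fun x => f x - s x) 2 (E.diag φ)))
        (Or.inr hC)
    refine tendsto_of_tendsto_of_tendsto_of_le_of_le tendsto_const_nhds h3
      (fun _ => zero_le) fun s => ?_
    refine le_trans (le_of_eq ?_) (hb _ (hfm.sub s.measurable))
    refine lintegral_congr fun x => ?_
    rw [← sub_mul, enorm_mul, enorm_mul, ← enorm_neg, neg_sub]
  refine tendsto_nhds_unique h1 (h2.congr fun s => ?_)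
  rw [(integral_simpleFunc_mul hk s).2, simpleIntegral, inner_sum]
  refine Finset.sum_congr rfl fun c _ => ?_
  rw [inner_smul_right, hE _ (s.measurableSet_fiber c)]

end SpectralMeasure

/-! ### The spectral density and its matrix elements. -/

namespace IsSpectralDensity

variable {𝓗 X : Type*} [NormedAddCommGroup 𝓗] [InnerProductSpace ℂ 𝓗] [CompleteSpace 𝓗]
  [NormedAddCommGroup X] [NormedSpace ℂ X] {E : SpectralMeasure 𝓗} {ι : X →L[ℂ] 𝓗} {J : Set ℝ}
  {A : ℝ → X →L[ℂ] (X →L⋆[ℂ] ℂ)}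

theorem pac_proj_apply (hA : IsSpectralDensity E ι J A) (hJ : MeasurableSet J) {S : Set ℝ}
    (hS : MeasurableSet S) (hSJ : S ⊆ J) (φ : 𝓗) : E.pac (E.proj S φ) = E.proj S φ := by
  have h : E.proj S φ = E.proj J (E.proj S φ) := by
    rw [E.proj_proj_apply hJ hS, Set.inter_eq_right.2 hSJ]
  rw [h]
  exact congrArg (fun T : 𝓗 →L[ℂ] 𝓗 => T (E.proj S φ)) hA.pac_proj

theorem proj_pac_apply (hA : IsSpectralDensity E ι J A) (hJ : MeasurableSet J) {S : Set ℝ}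
    (hS : MeasurableSet S) (hSJ : S ⊆ J) (φ : 𝓗) : E.proj S (E.pac φ) = E.proj S φ := by
  refine ext_inner_left ℂ fun v => ?_
  rw [← E.inner_proj_left hS, ← E.inner_proj_left hS, SpectralMeasure.pac,
    ← Submodule.inner_starProjection_left_eq_right]
  exact congrArg (fun w => inner ℂ w φ) (hA.pac_proj_apply hJ hS hSJ v)

theorem sub_eq_inner_proj_Ico (hA : IsSpectralDensity E ι J A) (hJ : MeasurableSet J) {c d : ℝ}
    (hcd : c ≤ d) (hJcd : Set.Icc c d ⊆ J) (f g : X) :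
    inner ℂ (ι g) (E.proj (Set.Iio d) (E.pac (ι f))) -
      inner ℂ (ι g) (E.proj (Set.Iio c) (E.pac (ι f))) =
      inner ℂ (ι g) (E.proj (Set.Ico c d) (ι f)) := by
  have h : Set.Iio d = Set.Iio c ∪ Set.Ico c d := (Set.Iio_union_Ico_eq_Iio hcd).symm
  have hd : Disjoint (Set.Iio c) (Set.Ico c d) := by
    refine Set.disjoint_left.2 fun x hx hx' => ?_
    exact absurd hx'.1 (not_le.2 hx)
  rw [h, E.proj_union_apply measurableSet_Iio measurableSet_Ico hd, inner_add_right,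
    add_sub_cancel_left,
    hA.proj_pac_apply hJ measurableSet_Ico (Set.Ico_subset_Icc_self.trans hJcd)]

theorem inner_proj_Ico (hA : IsSpectralDensity E ι J A) (hJ : MeasurableSet J) {c d : ℝ}
    (hcd : c ≤ d) (hJcd : Set.Icc c d ⊆ J) (f g : X) :
    inner ℂ (ι g) (E.proj (Set.Ico c d) (ι f)) = ∫ l in Set.Ico c d, A l f g := by
  rw [← hA.sub_eq_inner_proj_Ico hJ hcd hJcd f g, integral_Ico_eq_integral_Ioc,
    ← intervalIntegral.integral_of_le hcd]
  refine (intervalIntegral.integral_eq_sub_of_hasDerivAt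
    (f := fun l : ℝ => inner ℂ (ι g) (E.proj (Set.Iio l) (E.pac (ι f)))) ?_ ?_).symm
  · intro l hl
    rw [Set.uIcc_of_le hcd] at hl
    exact hA.hasDerivAt f g l (hJcd hl)
  · refine ContinuousOn.intervalIntegrable ?_
    rw [Set.uIcc_of_le hcd]
    exact (hA.weakly_continuous f g).mono hJcd

/-- Right difference quotients involve projections only, so pointwise inequalities for projections
pass to `A`. -/
theorem tendsto_inner_proj_Ico (hA : IsSpectralDensity E ι J A) (hJ : IsOpen J) (f g : X) {l : ℝ}
    (hl : l ∈ J) :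
    Tendsto (fun y : ℝ => ((y - l)⁻¹ : ℝ) • inner ℂ (ι g) (E.proj (Set.Ico l y) (ι f)))
      (𝓝[>] l) (𝓝 (A l f g)) := by
  have h := (hasDerivWithinAt_iff_tendsto_slope' Set.self_notMem_Ioi).1
    ((hA.hasDerivAt f g l hl).hasDerivWithinAt (s := Set.Ioi l))
  obtain ⟨ε, hε, hεJ⟩ := Metric.isOpen_iff.1 hJ l hl
  refine h.congr' ?_
  filter_upwards [Ioo_mem_nhdsGT (show l < l + ε by linarith)] with y hy
  rw [slope_def_module, hA.sub_eq_inner_proj_Ico hJ.measurableSet hy.1.le]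
  intro x hx
  refine hεJ ?_
  rw [Real.ball_eq_Ioo]
  exact ⟨by linarith [hx.1], by linarith [hx.2, hy.2]⟩

/-- A limit of the nonnegative numbers `‖E([l, y))f‖² / (y - l)` is nonnegative. -/
theorem apply_self_eq_norm (hA : IsSpectralDensity E ι J A) (hJ : IsOpen J) (f : X) {l : ℝ}
    (hl : l ∈ J) : A l f f = (‖A l f f‖ : ℂ) := by
  have h := hA.tendsto_inner_proj_Ico hJ f f hl
  have h2 := (Complex.continuous_ofReal.tendsto _).comp h.norm
  refine tendsto_nhds_unique h (h2.congr' ?_)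
  filter_upwards [self_mem_nhdsWithin] with y hy
  have hy' : 0 < y - l := sub_pos.2 hy
  have h3 : inner ℂ (ι f) (E.proj (Set.Ico l y) (ι f)) =
      ((‖E.proj (Set.Ico l y) (ι f)‖ ^ 2 : ℝ) : ℂ) := by
    have := E.inner_proj_proj (measurableSet_Ico (a := l) (b := y))
      (measurableSet_Ico (a := l) (b := y)) (ι f) (ι f)
    rw [Set.inter_self] at this
    rw [← this, inner_self_eq_norm_sq_to_K]
    norm_cast
  rw [Function.comp, h3, Complex.real_smul, ← Complex.ofReal_mul, Complex.norm_real,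
    Real.norm_of_nonneg (by positivity)]

/-- Cauchy–Schwarz in `𝓗` for the projected vectors, divided by `(y - l)²`, survives the limit. -/
theorem norm_apply_sq_le (hA : IsSpectralDensity E ι J A) (hJ : IsOpen J) (f g : X) {l : ℝ}
    (hl : l ∈ J) : ‖A l f g‖ ^ 2 ≤ ‖A l f f‖ * ‖A l g g‖ := by
  refine le_of_tendsto_of_tendsto' ((hA.tendsto_inner_proj_Ico hJ f g hl).norm.pow 2)
    ((hA.tendsto_inner_proj_Ico hJ f f hl).norm.mul (hA.tendsto_inner_proj_Ico hJ g g hl).norm)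
    fun y => ?_
  have hm := measurableSet_Ico (a := l) (b := y)
  have h3 : ∀ u v : X, inner ℂ (ι u) (E.proj (Set.Ico l y) (ι v)) =
      inner ℂ (E.proj (Set.Ico l y) (ι u)) (E.proj (Set.Ico l y) (ι v)) := fun u v => by
    rw [E.inner_proj_proj hm hm, Set.inter_self]
  have h4 : ∀ v : 𝓗, ‖inner ℂ v v‖ = ‖v‖ ^ 2 := fun v => by
    rw [inner_self_eq_norm_sq_to_K, norm_pow, RCLike.norm_ofReal, abs_norm]
  rw [h3 g f, h3 f f, h3 g g, norm_smul, norm_smul, norm_smul, h4, h4, mul_pow]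
  have := norm_inner_le_norm (𝕜 := ℂ) (E.proj (Set.Ico l y) (ι g)) (E.proj (Set.Ico l y) (ι f))
  calc _ ≤ ‖(y - l)⁻¹‖ ^ 2 *
        (‖E.proj (Set.Ico l y) (ι g)‖ * ‖E.proj (Set.Ico l y) (ι f)‖) ^ 2 := by gcongr
    _ = _ := by ring

theorem aemeasurable_apply (hA : IsSpectralDensity E ι J A) (hJ : MeasurableSet J) (f g : X)
    {S : Set ℝ} (hSJ : S ⊆ J) :
    AEMeasurable (fun l => A l f g) (volume.restrict S) :=
  ((hA.weakly_continuous f g).aemeasurable hJ).mono_set hSJ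

theorem diag_restrict (hA : IsSpectralDensity E ι J A) (hJ : IsOpen J) (f : X) :
    (E.diag (ι f)).restrict J = (volume.restrict J).withDensity fun l => ‖A l f f‖ₑ := by
  -- Countably many compact intervals inside `J` suffice; on each, continuity gives the
  -- integrability that is not yet known on all of `J`.
  let I := {p : ℚ × ℚ // Set.Icc (p.1 : ℝ) p.2 ⊆ J}
  have hU : (⋃ p : I, Set.Ico ((p.1.1 : ℚ) : ℝ) p.1.2) = J := by
    refine Set.Subset.antisymm (Set.iUnion_subset fun p => Set.Ico_subset_Icc_self.trans p.2) ?_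
    intro x hx
    obtain ⟨ε, hε, hεJ⟩ := Metric.isOpen_iff.1 hJ x hx
    obtain ⟨p, hp1, hp2⟩ := exists_rat_btwn (show x - ε < x by linarith)
    obtain ⟨q, hq1, hq2⟩ := exists_rat_btwn (show x < x + ε by linarith)
    refine Set.mem_iUnion.2 ⟨⟨(p, q), fun y hy => hεJ ?_⟩, ⟨hp2.le, hq1⟩⟩
    rw [Real.ball_eq_Ioo]
    exact ⟨by linarith [hy.1], by linarith [hy.2]⟩
  rw [← restrict_withDensity hJ.measurableSet, ← hU, Measure.restrict_iUnion_congr]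
  rintro ⟨⟨p, q⟩, hpq⟩
  refine Measure.ext_of_Ico _ _ fun c d _ => ?_
  simp only at hpq ⊢
  rw [Measure.restrict_apply measurableSet_Ico, Measure.restrict_apply measurableSet_Ico,
    Set.Ico_inter_Ico]
  set u := c ⊔ (p : ℝ)
  set v := d ⊓ (q : ℝ)
  rcases le_or_gt v u with huv | huv
  · simp [Set.Ico_eq_empty_of_le huv]
  have hsub : Set.Icc u v ⊆ J := (Set.Icc_subset_Icc le_sup_right inf_le_right).trans hpq
  have hsub' : Set.Ico u v ⊆ J := Set.Ico_subset_Icc_self.trans hsub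
  rw [withDensity_apply _ measurableSet_Ico, E.diag_apply _ measurableSet_Ico,
    ← E.re_inner_proj _ measurableSet_Ico,
    hA.inner_proj_Ico hJ.measurableSet huv.le hsub]
  have h1 : ∫ l in Set.Ico u v, A l f f = ((∫ l in Set.Ico u v, ‖A l f f‖ : ℝ) : ℂ) := by
    rw [← integral_complex_ofReal]
    exact setIntegral_congr_fun measurableSet_Ico fun l hl =>
      hA.apply_self_eq_norm hJ f (hsub' hl)
  rw [h1, RCLike.re_to_complex, Complex.ofReal_re]
  refine ofReal_integral_norm_eq_lintegral_enorm ?_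
  exact (((hA.weakly_continuous f f).mono hsub).integrableOn_Icc).mono_set
    Set.Ico_subset_Icc_self

/-- The integral is the spectral mass `μ_f(J)`, finite even for unbounded `J`. -/
theorem lintegral_enorm_apply_self_lt_top (hA : IsSpectralDensity E ι J A) (hJ : IsOpen J)
    (f : X) : ∫⁻ l in J, ‖A l f f‖ₑ < ∞ := by
  have h := congrArg (fun μ : Measure ℝ => μ Set.univ) (hA.diag_restrict hJ f)
  simp only [withDensity_apply _ MeasurableSet.univ, Measure.restrict_univ] at h
  rw [← h]
  exact measure_lt_top _ _

theorem integrableOn_apply (hA : IsSpectralDensity E ι J A) (hJ : IsOpen J) (f g : X) :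
    IntegrableOn (fun l => A l f g) J := by
  have hself : ∀ f : X, IntegrableOn (fun l => A l f f) J := fun f =>
    ⟨(hA.aemeasurable_apply hJ.measurableSet f f subset_rfl).aestronglyMeasurable,
      hA.lintegral_enorm_apply_self_lt_top hJ f⟩
  refine ((hself f).norm.add (hself g).norm).mono'
    (hA.aemeasurable_apply hJ.measurableSet f g subset_rfl).aestronglyMeasurable ?_
  filter_upwards [ae_restrict_mem hJ.measurableSet] with l hl
  have := hA.norm_apply_sq_le hJ f g hl
  simp only [Pi.add_apply]
  refine abs_le_of_sq_le_sq' ?_ (by positivity) |>.2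
  nlinarith [norm_nonneg (A l f f), norm_nonneg (A l g g)]

theorem inner_proj_self (hA : IsSpectralDensity E ι J A) (hJ : IsOpen J) (f : X) {B : Set ℝ}
    (hB : MeasurableSet B) (hBJ : B ⊆ J) :
    inner ℂ (ι f) (E.proj B (ι f)) = ∫ l in B, A l f f := by
  have h0 := E.inner_proj_proj hB hB (ι f) (ι f)
  rw [Set.inter_self, inner_self_eq_norm_sq_to_K] at h0
  have h := congrArg (fun μ : Measure ℝ => μ B) (hA.diag_restrict hJ f)
  simp only [withDensity_apply _ hB, Measure.restrict_apply hB, Measure.restrict_restrict hB,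
    Set.inter_eq_left.2 hBJ, E.diag_apply _ hB] at h
  rw [← ofReal_integral_norm_eq_lintegral_enorm ((hA.integrableOn_apply hJ f f).mono_set hBJ),
    ENNReal.ofReal_eq_ofReal_iff (by positivity) (by positivity)] at h
  rw [← h0]
  have h1 : ∫ l in B, A l f f = ((∫ l in B, ‖A l f f‖ : ℝ) : ℂ) := by
    rw [← integral_complex_ofReal]
    exact setIntegral_congr_fun hB fun l hl => hA.apply_self_eq_norm hJ f (hBJ hl)
  rw [h1, ← h]
  norm_cast

theorem sesquilinear_polarization (S : X →ₗ[ℂ] X →ₗ⋆[ℂ] ℂ) (f g : X) :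
    S f g = (1 / 4) * (S (f + g) (f + g) - S (f - g) (f - g) +
      Complex.I * S (f + Complex.I • g) (f + Complex.I • g) -
      Complex.I * S (f - Complex.I • g) (f - Complex.I • g)) := by
  simp only [map_add, map_sub, LinearMap.map_smulₛₗ, LinearMap.add_apply, LinearMap.sub_apply,
    LinearMap.smul_apply, smul_eq_mul, Complex.conj_I, RingHom.id_apply]
  linear_combination (1 / 2 * S f g - 1 / 2 * S g f) * Complex.I_sq

/-- `(E(B)f, g) = ∫_B ⟨A(l)f, g⟩ dl` for Borel sets `B ⊆ J`. -/
theorem inner_proj (hA : IsSpectralDensity E ι J A) (hJ : IsOpen J) (f g : X) {B : Set ℝ}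
    (hB : MeasurableSet B) (hBJ : B ⊆ J) :
    inner ℂ (ι g) (E.proj B (ι f)) = ∫ l in B, A l f g := by
  -- Both sides are sesquilinear, so polarization reduces the identity to the diagonal case
  -- `inner_proj_self`.
  let S : X →ₗ[ℂ] X →ₗ⋆[ℂ] ℂ := LinearMap.mk₂'ₛₗ (RingHom.id ℂ) (starRingEnd ℂ)
    (fun f g => inner ℂ (ι g) (E.proj B (ι f)))
    (by intros; simp) (by intros; simp)
    (by intros; simp) (by intros; simp [mul_comm])
  let S' : ℝ → X →ₗ[ℂ] X →ₗ⋆[ℂ] ℂ := fun l => LinearMap.mk₂'ₛₗ (RingHom.id ℂ) (starRingEnd ℂ)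
    (fun f g => A l f g)
    (by intros; simp) (by intros; simp) (by intros; simp) (by intros; simp)
  have h1 := sesquilinear_polarization S f g
  have h2 := fun l => sesquilinear_polarization (S' l) f g
  simp only [S, S', LinearMap.mk₂'ₛₗ_apply] at h1 h2
  have hi : ∀ f : X, IntegrableOn (fun l => A l f f) B := fun f =>
    (hA.integrableOn_apply hJ f f).mono_set hBJ
  rw [h1, setIntegral_congr_fun hB fun l _ => h2 l, integral_const_mul, integral_sub,
    integral_add, integral_sub, integral_const_mul, integral_const_mul]
  · simp only [hA.inner_proj_self hJ _ hB hBJ]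
  · exact hi _
  · exact hi _
  · exact (hi _).sub (hi _)
  · exact (hi _).const_mul _
  · exact ((hi _).sub (hi _)).add ((hi _).const_mul _)
  · exact (hi _).const_mul _

/-- Cauchy–Schwarz twice: pointwise for `A l`, then in `l`. Since `⟨Af, f⟩` is the density of `μ_f`,
one factor is an `L²(μ_f)` norm. This is the bound required by `inner_integral`. -/
theorem lintegral_enorm_mul_apply_le (hA : IsSpectralDensity E ι J A) (hJ : IsOpen J) (f g : X)
    {S : Set ℝ} (hS : MeasurableSet S) (hSJ : S ⊆ J) (θ : ℝ → ℂ) (hθ : Measurable θ) :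
    ∫⁻ l in S, ‖θ l * A l f g‖ₑ ≤
      (∫⁻ l in J, ‖A l g g‖ₑ) ^ (1 / 2 : ℝ) * eLpNorm θ 2 (E.diag (E.proj S (ι f))) := by
  have hm := fun f => (hA.aemeasurable_apply hJ.measurableSet f f hSJ).enorm
  have h1 : eLpNorm θ 2 (E.diag (E.proj S (ι f))) =
      (∫⁻ l in S, (‖θ l‖ₑ * ‖A l f f‖ₑ ^ (1 / 2 : ℝ)) ^ (2 : ℝ)) ^ (1 / 2 : ℝ) := by
    have hr := congrArg (fun μ : Measure ℝ => μ.restrict S) (hA.diag_restrict hJ f)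
    simp only [Measure.restrict_restrict hS, Set.inter_eq_left.2 hSJ,
      restrict_withDensity hS] at hr
    rw [eLpNorm_eq_lintegral_rpow_enorm_toReal (by norm_num) (by norm_num), E.diag_proj hS, hr,
      lintegral_withDensity_eq_lintegral_mul₀ (hm f) (by fun_prop)]
    simp only [ENNReal.toReal_ofNat]
    congr 1
    refine lintegral_congr fun l => ?_
    rw [ENNReal.mul_rpow_of_nonneg _ _ (by norm_num), ← ENNReal.rpow_mul, Pi.mul_apply, mul_comm]
    norm_num
  calc ∫⁻ l in S, ‖θ l * A l f g‖ₑ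
      ≤ ∫⁻ l in S, ((fun l => ‖θ l‖ₑ * ‖A l f f‖ₑ ^ (1 / 2 : ℝ)) *
          fun l => ‖A l g g‖ₑ ^ (1 / 2 : ℝ)) l := by
        refine lintegral_mono_ae ?_
        filter_upwards [ae_restrict_mem hS] with l hl
        rw [enorm_mul, Pi.mul_apply, mul_assoc]
        gcongr
        rw [← ENNReal.mul_rpow_of_nonneg _ _ (by norm_num : (0 : ℝ) ≤ 1 / 2), one_div,
          ENNReal.le_rpow_inv_iff (by norm_num), ENNReal.rpow_two, ← ofReal_norm, ← ofReal_norm,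
          ← ofReal_norm, ← ENNReal.ofReal_pow (norm_nonneg _),
          ← ENNReal.ofReal_mul (norm_nonneg _)]
        exact ENNReal.ofReal_le_ofReal (hA.norm_apply_sq_le hJ f g (hSJ hl))
    _ ≤ (∫⁻ l in S, (‖θ l‖ₑ * ‖A l f f‖ₑ ^ (1 / 2 : ℝ)) ^ (2 : ℝ)) ^ (1 / (2 : ℝ)) *
          (∫⁻ l in S, (‖A l g g‖ₑ ^ (1 / 2 : ℝ)) ^ (2 : ℝ)) ^ (1 / (2 : ℝ)) := by
        refine ENNReal.lintegral_mul_le_Lp_mul_Lq _ Real.HolderConjugate.two_two ?_ ?_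
        · exact hθ.enorm.aemeasurable.mul ((hm f).pow_const _)
        · exact (hm g).pow_const _
    _ ≤ _ := by
        rw [← h1, mul_comm]
        refine mul_le_mul_left (ENNReal.rpow_le_rpow ?_ (by norm_num)) _
        refine (lintegral_mono_set hSJ).trans (le_of_eq (lintegral_congr fun l => ?_))
        rw [← ENNReal.rpow_mul]
        norm_num

/-- The matrix elements of the functional calculus on `E(S)`, `S ⊆ J`. -/
theorem inner_integral_proj (hA : IsSpectralDensity E ι J A) (hJ : IsOpen J) (f g : X)
    {S : Set ℝ} (hS : MeasurableSet S) (hSJ : S ⊆ J) {θ : ℝ → ℂ} (hθ : Measurable θ)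
    (hd : E.InDomain θ (E.proj S (ι f))) :
    IntegrableOn (fun l => θ l * A l f g) S ∧
      inner ℂ (ι g) (E.integral θ (E.proj S (ι f))) = ∫ l in S, θ l * A l f g := by
  refine SpectralMeasure.inner_integral ((hA.integrableOn_apply hJ f g).mono_set hSJ)
    (fun B hB => ?_) ?_ (hA.lintegral_enorm_mul_apply_le hJ f g hS hSJ) hθ hd
  · rw [E.proj_proj_apply hB hS, Measure.restrict_restrict hB,
      hA.inner_proj hJ f g (hB.inter hS) (Set.inter_subset_right.trans hSJ)]
  · exact ENNReal.rpow_ne_top_of_nonneg (by norm_num)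
      (hA.lintegral_enorm_apply_self_lt_top hJ g).ne

end IsSpectralDensity

/-- Plancherel's theorem after the change of variables `η = a(x)`. -/
theorem lintegral_integral_exp_comp_sq {S : Set ℝ} (hS : MeasurableSet S) {a : ℝ → ℝ}
    (ha : ∀ x ∈ S, DifferentiableAt ℝ a x) (ha' : ∀ x ∈ S, 0 < deriv a x) (hinj : Set.InjOn a S)
    {h : ℝ → ℂ} (hh : IntegrableOn h S) :
    ∫⁻ t : ℝ, ‖∫ x in S, Complex.exp (Complex.I * t * a x) * h x‖ₑ ^ 2 =
      ENNReal.ofReal (2 * Real.pi) * ∫⁻ x in S, ‖h x‖ₑ ^ 2 / ENNReal.ofReal (deriv a x) := by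
  have hd : ∀ x ∈ S, HasDerivWithinAt a (deriv a x) S x :=
    fun x hx => (ha x hx).hasDerivAt.hasDerivWithinAt
  have himg : MeasurableSet (a '' S) :=
    measurable_image_of_fderivWithin hS (fun x hx => (hd x hx).hasFDerivWithinAt) hinj
  let b := Function.invFunOn a S
  have hb : ∀ x ∈ S, b (a x) = x := fun x hx => hinj.leftInvOn_invFunOn hx
  -- Chosen so that the Jacobian cancels in `∫ g`; in `∫ |g|²` one factor `1 / a'` remains.
  let g : ℝ → ℂ := fun η => (deriv a (b η))⁻¹ • h (b η)
  have hg : ∀ x ∈ S, |deriv a x| • g (a x) = h x := fun x hx => by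
    simp only [g, hb x hx, abs_of_pos (ha' x hx)]
    rw [smul_smul, mul_inv_cancel₀ (ha' x hx).ne', one_smul]
  have hgi : IntegrableOn g (a '' S) := by
    rw [integrableOn_image_iff_integrableOn_abs_deriv_smul hS hd hinj]
    exact hh.congr_fun (fun x hx => (hg x hx).symm) hS
  have h1 := lintegral_integral_exp_mul_sq ((integrable_indicator_iff himg).2 hgi)
  have h2 : ∀ t : ℝ, ∫ η : ℝ, Complex.exp (Complex.I * t * η) * (a '' S).indicator g η =
      ∫ x in S, Complex.exp (Complex.I * t * a x) * h x := fun t => by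
    have h3 : (fun η : ℝ => Complex.exp (Complex.I * t * η) * (a '' S).indicator g η) =
        (a '' S).indicator fun η : ℝ => Complex.exp (Complex.I * t * η) * g η := by
      ext η
      by_cases hη : η ∈ a '' S <;> simp [hη]
    rw [h3, integral_indicator himg, integral_image_eq_integral_abs_deriv_smul hS hd hinj]
    refine setIntegral_congr_fun hS fun x hx => ?_
    rw [← mul_smul_comm, hg x hx]
  have h4 : ∫⁻ η, ‖(a '' S).indicator g η‖ₑ ^ 2 =
      ∫⁻ x in S, ‖h x‖ₑ ^ 2 / ENNReal.ofReal (deriv a x) := by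
    have h3 : (fun η : ℝ => ‖(a '' S).indicator g η‖ₑ ^ 2) =
        (a '' S).indicator fun η : ℝ => ‖g η‖ₑ ^ 2 := by
      ext η
      by_cases hη : η ∈ a '' S <;> simp [hη]
    rw [h3, lintegral_indicator himg, lintegral_image_eq_lintegral_abs_deriv_mul hS hd hinj]
    refine setLIntegral_congr_fun hS fun x hx => ?_
    have hp := ENNReal.ofReal_pos.2 (ha' x hx)
    simp only [g, hb x hx, abs_of_pos (ha' x hx), enorm_smul]
    rw [Real.enorm_of_nonneg (inv_nonneg.2 (ha' x hx).le), ENNReal.ofReal_inv_of_pos (ha' x hx),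
      mul_pow, pow_two (_⁻¹), ← mul_assoc, ← mul_assoc,
      ENNReal.mul_inv_cancel hp.ne' ENNReal.ofReal_ne_top, one_mul, mul_comm, ENNReal.div_eq_inv_mul,
      mul_comm]
  simp_rw [h2] at h1
  rw [h1, h4]

/-! ### Exact formulas for the norms of the evolution. -/

namespace IsSpectralDensity

variable {𝓗 X : Type*} [NormedAddCommGroup 𝓗] [InnerProductSpace ℂ 𝓗] [CompleteSpace 𝓗]
  [NormedAddCommGroup X] [NormedSpace ℂ X] {E : SpectralMeasure 𝓗} {ι : X →L[ℂ] 𝓗} {J : Set ℝ}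
  {A : ℝ → X →L[ℂ] (X →L⋆[ℂ] ℂ)} {σ a : ℝ → ℝ}

theorem measurable_indicator_propagator (hσ : IsAdmissible J σ a) {S : Set ℝ}
    (hS : MeasurableSet S) (hSJ : S ⊆ J) (t : ℝ) :
    Measurable (S.indicator fun x => (σ x : ℂ) * Complex.exp (Complex.I * t * a x)) := by
  obtain ⟨hc, N, hN, -, ha, -, -⟩ := hσ
  have h1 : Measurable ((S \ N).indicator
      fun x => (σ x : ℂ) * Complex.exp (Complex.I * t * a x)) := by
    classical
    rw [← Set.piecewise_eq_indicator]
    refine ContinuousOn.measurable_piecewise ?_ continuousOn_const (hS.diff hN.measurableSet)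
    have h2 : ContinuousOn σ (S \ N) := hc.mono (Set.sdiff_subset.trans hSJ)
    have h3 : ContinuousOn a (S \ N) := ha.continuousOn.mono (Set.sdiff_subset_sdiff_left hSJ)
    have h4 := Complex.continuous_ofReal.comp_continuousOn h2
    have h5 := Complex.continuous_ofReal.comp_continuousOn h3
    exact h4.mul (Complex.continuous_exp.comp_continuousOn (continuousOn_const.mul h5))
  -- Nothing is known about `a` on `N`, but changing values on a countable set preserves
  -- measurability.
  refine h1.measurable_of_countable_ne (hN.countable.mono fun x hx => ?_)
  by_contra hxN
  exact hx (by by_cases hxS : x ∈ S <;> simp [hxS, hxN])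

theorem inDomain_propagator (hσ : IsAdmissible J σ a) {S : Set ℝ}
    (hS : MeasurableSet S) (hSJ : S ⊆ J) {φ : 𝓗}
    (hd : E.InDomain (S.indicator fun x => (σ x : ℂ)) φ) (t : ℝ) :
    E.InDomain (S.indicator fun x => (σ x : ℂ) * Complex.exp (Complex.I * t * a x)) φ := by
  refine MemLp.mono hd
    (measurable_indicator_propagator hσ hS hSJ t).aestronglyMeasurable
    (Eventually.of_forall fun x => ?_)
  by_cases hx : x ∈ S
  · have : Complex.I * t * a x = ((t * a x : ℝ) : ℂ) * Complex.I := by push_cast; ring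
    rw [Set.indicator_of_mem hx, Set.indicator_of_mem hx, norm_mul, this,
      Complex.norm_exp_ofReal_mul_I, mul_one]
  · simp [hx]

/-- `(σ(H) e^{i t a(H)} E(S)f, g) = ∫_S e^{i t a(l)} σ(l) ⟨A(l)f, g⟩ dl`. -/
theorem inner_evolution (hA : IsSpectralDensity E ι J A) (hJ : IsOpen J)
    (hσ : IsAdmissible J σ a) (f g : X) {S : Set ℝ} (hS : MeasurableSet S) (hSJ : S ⊆ J)
    (hd : E.InDomain (S.indicator fun x => (σ x : ℂ)) (E.pac (E.proj S (ι f)))) (t : ℝ) :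
    IntegrableOn (fun l => Complex.exp (Complex.I * t * a l) * (σ l * A l f g)) S ∧
    inner ℂ (ι g) (E.evolution σ a S (ι f) t) =
      ∫ l in S, Complex.exp (Complex.I * t * a l) * (σ l * A l f g) := by
  rw [SpectralMeasure.evolution]
  rw [hA.pac_proj_apply hJ.measurableSet hS hSJ] at hd ⊢
  have h := hA.inner_integral_proj hJ f g hS hSJ (measurable_indicator_propagator hσ hS hSJ t)
    (inDomain_propagator hσ hS hSJ hd t)
  have heq : Set.EqOn
      (fun l => S.indicator (fun x => (σ x : ℂ) * Complex.exp (Complex.I * t * a x)) l * A l f g)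
      (fun l => Complex.exp (Complex.I * t * a l) * (σ l * A l f g)) S := fun l hl => by
    simp only [Set.indicator_of_mem hl]
    ring
  exact ⟨h.1.congr_fun heq hS, h.2.trans (setIntegral_congr_fun hS heq)⟩

/-- Dominated convergence with a unimodular phase. It supplies the measurability in `t` for
exchanging sum and integral in the global case. -/
theorem continuous_inner_evolution (hA : IsSpectralDensity E ι J A) (hJ : IsOpen J)
    (hσ : IsAdmissible J σ a) (f g : X) {S : Set ℝ} (hS : MeasurableSet S) (hSJ : S ⊆ J)
    (hd : E.InDomain (S.indicator fun x => (σ x : ℂ)) (E.pac (E.proj S (ι f)))) :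
    Continuous fun t => inner ℂ (ι g) (E.evolution σ a S (ι f) t) := by
  have h := hA.inner_evolution hJ hσ f g hS hSJ hd
  simp_rw [fun t => (h t).2]
  refine continuous_of_dominated (fun t => (h t).1.1)
    (bound := fun l => ‖(σ l * A l f g : ℂ)‖) (fun t => Eventually.of_forall fun l => ?_) ?_
    (Eventually.of_forall fun l => by fun_prop)
  · have : Complex.I * t * a l = ((t * a l : ℝ) : ℂ) * Complex.I := by push_cast; ring
    rw [norm_mul, this, Complex.norm_exp_ofReal_mul_I, one_mul]
  · simpa using (h 0).1.norm

theorem lintegral_inner_evolution_sq (hA : IsSpectralDensity E ι J A) (hJ : IsOpen J)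
    (hσ : IsAdmissible J σ a) (f g : X) {S : Set ℝ} (hS : MeasurableSet S) (hSJ : S ⊆ J)
    (hd : E.InDomain (S.indicator fun x => (σ x : ℂ)) (E.pac (E.proj S (ι f)))) :
    ∫⁻ t, ‖inner ℂ (ι g) (E.evolution σ a S (ι f) t)‖ₑ ^ 2 =
      ENNReal.ofReal (2 * Real.pi) *
        ∫⁻ l in S, ‖σ l‖ₑ ^ 2 / ENNReal.ofReal (deriv a l) * ‖A l f g‖ₑ ^ 2 := by
  have h := hA.inner_evolution hJ hσ f g hS hSJ hd
  obtain ⟨-, N, hN, hNJ, ha, hpos, hinj⟩ := hσ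
  have hop : IsOpen (J \ N) := hJ.sdiff hN.isClosed
  have hsub : S \ N ⊆ J \ N := Set.sdiff_subset_sdiff_left hSJ
  have hae : (S \ N : Set ℝ) =ᵐ[volume] S := sdiff_null_ae_eq_self (hN.measure_zero _)
  have hi : IntegrableOn (fun l => (σ l * A l f g : ℂ)) (S \ N) := by
    -- At `t = 0` the phase is `1`, which leaves integrability of `σ ⟨Af, g⟩` itself.
    have := (h 0).1
    simp only [Complex.ofReal_zero, mul_zero, zero_mul, Complex.exp_zero, one_mul] at this
    exact this.mono_set Set.sdiff_subset
  have key := lintegral_integral_exp_comp_sq (hS.diff hN.measurableSet)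
    (fun x hx => (ha.differentiableOn one_ne_zero).differentiableAt (hop.mem_nhds (hsub hx)))
    (fun x hx => hpos x (hsub hx)) (hinj.mono hsub) hi
  simp_rw [fun t => (h t).2, fun t : ℝ => setIntegral_congr_set (μ := volume)
    (f := fun l => Complex.exp (Complex.I * t * a l) * (σ l * A l f g)) hae.symm]
  rw [key, setLIntegral_congr hae]
  congr 1
  refine lintegral_congr fun l => ?_
  rw [enorm_mul, mul_pow, ← ofReal_norm (σ l : ℂ), Complex.norm_real, ofReal_norm,
    ENNReal.div_eq_inv_mul, ENNReal.div_eq_inv_mul, mul_assoc]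

theorem inDomain_of_isCompact (hσ : ContinuousOn σ J) {K : Set ℝ} (hK : IsCompact K)
    (hKJ : K ⊆ J) (φ : 𝓗) : E.InDomain (K.indicator fun x => (σ x : ℂ)) φ := by
  obtain ⟨C, hC⟩ := hK.exists_bound_of_continuousOn (hσ.mono hKJ)
  have hm : Measurable (K.indicator fun x => (σ x : ℂ)) := by
    classical
    rw [← Set.piecewise_eq_indicator]
    exact ContinuousOn.measurable_piecewise
      (Complex.continuous_ofReal.comp_continuousOn (hσ.mono hKJ)) continuousOn_const
      hK.measurableSet
  refine MemLp.of_bound hm.aestronglyMeasurable |C| (Eventually.of_forall fun x => ?_)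
  by_cases hx : x ∈ K
  · simpa [hx] using (hC x hx).trans (le_abs_self C)
  · simp [hx]

theorem exists_monotone_isCompact_iUnion_eq (hJ : IsOpen J) :
    ∃ K : ℕ → Set ℝ, (∀ n, IsCompact (K n)) ∧ Monotone K ∧ ⋃ n, K n = J := by
  obtain ⟨F, hF, -, hU, hmono⟩ := hJ.exists_iUnion_isClosed
  refine ⟨fun n => Metric.closedBall 0 n ∩ F n,
    fun n => (isCompact_closedBall _ _).inter_right (hF n), fun m n hmn =>
    Set.inter_subset_inter (Metric.closedBall_subset_closedBall (by exact_mod_cast hmn))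
      (hmono hmn), ?_⟩
  rw [Set.iUnion_inter_of_monotone (fun m n hmn =>
    Metric.closedBall_subset_closedBall (by exact_mod_cast hmn)) hmono, hU,
    Metric.iUnion_closedBall_nat, Set.univ_inter]

/-- If the squared norms over all admissible `S ⊆ J` are integrals of one density, then so is the
squared norm of the evolution over `J`, whether or not an energy cut-off is needed. -/
theorem evolutionNorm_sq_eq {Y : Type*} [NormedAddCommGroup Y] (hJ : IsOpen J)
    (hσ : ContinuousOn σ J) {Φ : 𝓗 → Y} {φ : 𝓗} {c : ℝ≥0∞} {D : ℝ → ℝ≥0∞}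
    (h : ∀ S, MeasurableSet S → S ⊆ J →
      E.InDomain (S.indicator fun x => (σ x : ℂ)) (E.pac (E.proj S φ)) →
      ∫⁻ t, ‖Φ (E.evolution σ a S φ t)‖ₑ ^ 2 = c * ∫⁻ l in S, D l) :
    E.evolutionNorm σ a J Φ φ ^ 2 = c * ∫⁻ l in J, D l := by
  rw [SpectralMeasure.evolutionNorm]
  split_ifs with hd
  · rw [eLpNorm_two_sq, h J hJ.measurableSet subset_rfl hd]
  have hK : ∀ K, IsCompact K → K ⊆ J →
      eLpNorm (fun t => Φ (E.evolution σ a K φ t)) 2 volume ^ 2 = c * ∫⁻ l in K, D l := by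
    intro K hK hKJ
    rw [eLpNorm_two_sq, h K hK.measurableSet hKJ (inDomain_of_isCompact hσ hK hKJ _)]
  refine le_antisymm ?_ ?_
  · rw [← ENNReal.rpow_two, ← ENNReal.le_rpow_inv_iff (by norm_num)]
    refine iSup_le fun K => iSup_le fun hKc => iSup_le fun hKJ => ?_
    rw [ENNReal.le_rpow_inv_iff (by norm_num), ENNReal.rpow_two, hK K hKc hKJ]
    gcongr
  -- Monotone convergence along a compact exhaustion: the supremum of the cut-off norms already
  -- attains the integral over `J`.
  · obtain ⟨K, hKc, hmono, hU⟩ := exists_monotone_isCompact_iUnion_eq hJ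
    conv_lhs => rw [← hU]
    rw [setLIntegral_iUnion_of_directed _ hmono.directed_le, ENNReal.mul_iSup]
    refine iSup_le fun n => ?_
    have hnJ : K n ⊆ J := hU ▸ Set.subset_iUnion K n
    rw [← hK (K n) (hKc n) hnJ]
    gcongr
    exact le_iSup_of_le (K n) (le_iSup_of_le (hKc n) (le_iSup_of_le hnJ le_rfl))

theorem evolutionNorm_inner_sq (hA : IsSpectralDensity E ι J A) (hJ : IsOpen J)
    (hσ : IsAdmissible J σ a) (f g : X) :
    E.evolutionNorm σ a J (fun u => inner ℂ (ι g) u) (ι f) ^ 2 =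
      ENNReal.ofReal (2 * Real.pi) *
        ∫⁻ l in J, ‖σ l‖ₑ ^ 2 / ENNReal.ofReal (deriv a l) * ‖A l f g‖ₑ ^ 2 :=
  evolutionNorm_sq_eq hJ hσ.1 fun _ hS hSJ hd =>
    hA.lintegral_inner_evolution_sq hJ hσ f g hS hSJ hd

end IsSpectralDensity

/-- Parseval's identity for a bounded antilinear functional on a Hilbert space. -/
theorem HilbertBasis.hasSum_norm_antilinear_sq {κ X : Type*} [NormedAddCommGroup X]
    [InnerProductSpace ℂ X] [CompleteSpace X] (b : HilbertBasis κ ℂ X) (F : X →L⋆[ℂ] ℂ) :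
    HasSum (fun i => ‖F (b i)‖ ^ 2) (‖F‖ ^ 2) := by
  -- Conjugation makes `F` linear without changing norms, so the Riesz representation applies.
  let F' : StrongDual ℂ X := ((starL ℂ : ℂ ≃L⋆[ℂ] ℂ) : ℂ →L⋆[ℂ] ℂ).comp F
  have hF' : ∀ x, ‖F' x‖ = ‖F x‖ := fun x => norm_star (F x)
  have hn : ‖F'‖ = ‖F‖ := le_antisymm
    (F'.opNorm_le_bound (norm_nonneg _) fun x => (hF' x).trans_le (F.le_opNorm x))
    (F.opNorm_le_bound (norm_nonneg _) fun x => (hF' x).symm.trans_le (F'.le_opNorm x))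
  let x := (InnerProductSpace.toDual ℂ X).symm F'
  have hx : ∀ y, ‖F y‖ = ‖inner ℂ x y‖ := fun y => by
    rw [← hF', ← InnerProductSpace.toDual_apply_apply, LinearIsometryEquiv.apply_symm_apply]
  have hxn : ‖x‖ = ‖F‖ := by rw [LinearIsometryEquiv.norm_map, hn]
  have h := (b.hasSum_inner_mul_inner x x).mapL Complex.reCLM
  simp only [Complex.reCLM_apply, ← RCLike.re_to_complex, inner_self_eq_norm_sq (𝕜 := ℂ), hxn] at h
  refine h.congr_fun fun i => ?_
  rw [hx, ← inner_conj_symm (b i) x, RCLike.mul_conj]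
  norm_cast

/-! ### The space-global identity. -/

namespace IsSpectralDensity

/-- `X` may be non-separable, while exchanging sum and integral needs a countable sum. One set `K`
serves every `F` that vanishes wherever all `A l f` do: both `A l f` itself and the embedded
evolution. -/
theorem exists_countable_parseval {𝓗 X : Type*} [NormedAddCommGroup 𝓗] [InnerProductSpace ℂ 𝓗]
    [CompleteSpace 𝓗] [NormedAddCommGroup X] [InnerProductSpace ℂ X] [CompleteSpace X]
    {E : SpectralMeasure 𝓗} {ι : X →L[ℂ] 𝓗} {J : Set ℝ}
    {A : ℝ → X →L[ℂ] (X →L⋆[ℂ] ℂ)} (hA : IsSpectralDensity E ι J A) (hJ : IsOpen J) (f : X) :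
    ∃ K : Set X, K.Countable ∧ ∀ F : X →L⋆[ℂ] ℂ, (∀ g, (∀ l ∈ J, A l f g = 0) → F g = 0) →
      ‖F‖ₑ ^ 2 = ∑' g : K, ‖F g‖ₑ ^ 2 := by
  obtain ⟨w, b, -⟩ := exists_hilbertBasis ℂ X
  -- Each `A q f` has countably many nonzero coefficients, and by weak continuity vanishing at
  -- rational points of `J` forces vanishing on `J`.
  let s : Set w := {i | ∃ q : ℚ, (q : ℝ) ∈ J ∧ A q f (b i) ≠ 0}
  have hs : s.Countable := by
    have : s ⊆ ⋃ q : ℚ, Function.support fun i => ‖A q f (b i)‖ ^ 2 := by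
      rintro i ⟨q, -, hq⟩
      exact Set.mem_iUnion.2 ⟨q, by simpa using hq⟩
    exact (Set.countable_iUnion fun q : ℚ =>
      (b.hasSum_norm_antilinear_sq (A q f)).summable.countable_support).mono this
  have hzero : ∀ i, i ∉ s → ∀ l ∈ J, A l f (b i) = 0 := by
    intro i hi
    refine Set.EqOn.of_subset_closure (s := J ∩ Set.range ((↑) : ℚ → ℝ)) (g := fun _ => 0) ?_
      (hA.weakly_continuous f (b i)) continuousOn_const Set.inter_subset_left
      (Rat.denseRange_cast.open_subset_closure_inter hJ)
    rintro _ ⟨hq, q, rfl⟩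
    by_contra h
    exact hi ⟨q, hq, h⟩
  refine ⟨b '' s, hs.image _, fun F hF => ?_⟩
  rw [tsum_image (fun g => ‖F g‖ₑ ^ 2) b.orthonormal.linearIndependent.injective.injOn,
    tsum_subtype s fun i => ‖F (b i)‖ₑ ^ 2]
  have h := b.hasSum_norm_antilinear_sq F
  have hF2 : ‖F‖ₑ ^ 2 = ∑' i, ‖F (b i)‖ₑ ^ 2 := by
    rw [← ofReal_norm, ← ENNReal.ofReal_pow (norm_nonneg _), ← h.tsum_eq,
      ENNReal.ofReal_tsum_of_nonneg (fun i => by positivity) h.summable]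
    refine tsum_congr fun i => ?_
    rw [ENNReal.ofReal_pow (norm_nonneg _), ofReal_norm]
  rw [hF2]
  refine tsum_congr fun i => ?_
  by_cases hi : i ∈ s
  · simp [hi]
  · simp [hi, hF _ (hzero i hi)]

theorem evolutionNorm_dualEmbedding_sq {𝓗 X : Type*} [NormedAddCommGroup 𝓗]
    [InnerProductSpace ℂ 𝓗] [CompleteSpace 𝓗] [NormedAddCommGroup X] [InnerProductSpace ℂ X]
    [CompleteSpace X] {E : SpectralMeasure 𝓗} {ι : X →L[ℂ] 𝓗} {J : Set ℝ}
    {A : ℝ → X →L[ℂ] (X →L⋆[ℂ] ℂ)} {σ a : ℝ → ℝ} (hA : IsSpectralDensity E ι J A) (hJ : IsOpen J)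
    (hσ : IsAdmissible J σ a) (f : X) :
    E.evolutionNorm σ a J (dualEmbedding ι) (ι f) ^ 2 =
      ENNReal.ofReal (2 * Real.pi) *
        ∫⁻ l in J, ‖σ l‖ₑ ^ 2 / ENNReal.ofReal (deriv a l) * ‖A l f‖ₑ ^ 2 := by
  refine evolutionNorm_sq_eq hJ hσ.1 fun S hS hSJ hd => ?_
  obtain ⟨K, hK, hpar⟩ := hA.exists_countable_parseval hJ f
  have := hK.to_subtype
  have h1 : ∀ t, ‖dualEmbedding ι (E.evolution σ a S (ι f) t)‖ₑ ^ 2 =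
      ∑' g : K, ‖inner ℂ (ι g) (E.evolution σ a S (ι f) t)‖ₑ ^ 2 := fun t => by
    refine hpar _ fun g hg => ?_
    rw [dualEmbedding_apply, (hA.inner_evolution hJ hσ f g hS hSJ hd t).2]
    refine (setIntegral_congr_fun hS fun l hl => ?_).trans (integral_zero _ _)
    simp only [hg l (hSJ hl), mul_zero]
  have h2 : ∀ l ∈ S, ‖σ l‖ₑ ^ 2 / ENNReal.ofReal (deriv a l) * ‖A l f‖ₑ ^ 2 =
      ∑' g : K, ‖σ l‖ₑ ^ 2 / ENNReal.ofReal (deriv a l) * ‖A l f g‖ₑ ^ 2 := fun l hl => by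
    rw [ENNReal.tsum_mul_left, hpar _ fun g hg => hg l (hSJ hl)]
  have h3 : AEMeasurable σ (volume.restrict S) := (hσ.1.aemeasurable hJ.measurableSet).mono_set hSJ
  have h4 : Measurable (deriv a) := measurable_deriv a
  simp_rw [h1]
  rw [setLIntegral_congr_fun hS h2, lintegral_tsum, lintegral_tsum, ← ENNReal.tsum_mul_left]
  · exact tsum_congr fun g => hA.lintegral_inner_evolution_sq hJ hσ f g hS hSJ hd
  · intro g
    have h5 := hA.aemeasurable_apply hJ.measurableSet f g hSJ
    fun_prop
  · intro g
    have := (hA.continuous_inner_evolution hJ hσ f g hS hSJ hd).measurable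
    exact (this.enorm.pow_const 2).aemeasurable

end IsSpectralDensity

/-! ### Comparison of the two evolutions. -/

theorem enorm_sq_div_mul_enorm_sq {s d : ℝ} (hd : 0 < d) {Y : Type*} [NormedAddCommGroup Y]
    (y : Y) : ‖s‖ₑ ^ 2 / ENNReal.ofReal d * ‖y‖ₑ ^ 2 =
      ENNReal.ofReal ((|s| / √|d| * ‖y‖) ^ 2) := by
  rw [mul_pow, div_pow, Real.sq_sqrt (abs_nonneg d), abs_of_pos hd,
    ENNReal.ofReal_mul (by positivity), ENNReal.ofReal_div_of_pos hd,
    ENNReal.ofReal_pow (abs_nonneg s), ENNReal.ofReal_pow (norm_nonneg y), ofReal_norm,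
    ← Real.norm_eq_abs, ofReal_norm]

theorem lintegral_weight_mono {J : Set ℝ} (hJ : IsOpen J) {σ a σ' a' : ℝ → ℝ}
    (hσ : IsAdmissible J σ a) (hσ' : IsAdmissible J σ' a') {Y Y' : Type*} [NormedAddCommGroup Y]
    [NormedAddCommGroup Y'] {y : ℝ → Y} {y' : ℝ → Y'}
    (h : ∀ᵐ l : ℝ, l ∈ J →
      |σ' l| / √|deriv a' l| * ‖y' l‖ ≤ |σ l| / √|deriv a l| * ‖y l‖) :
    ∫⁻ l in J, ‖σ' l‖ₑ ^ 2 / ENNReal.ofReal (deriv a' l) * ‖y' l‖ₑ ^ 2 ≤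
      ∫⁻ l in J, ‖σ l‖ₑ ^ 2 / ENNReal.ofReal (deriv a l) * ‖y l‖ₑ ^ 2 := by
  obtain ⟨-, N, hN, -, -, hpos, -⟩ := hσ
  obtain ⟨-, N', hN', -, -, hpos', -⟩ := hσ'
  refine lintegral_mono_ae ((ae_restrict_iff' hJ.measurableSet).2 ?_)
  -- Off the null exceptional sets the derivatives are positive, so the different conventions for
  -- division by zero in `ℝ` and `ℝ≥0∞` play no role.
  filter_upwards [h, hN.countable.ae_notMem volume, hN'.countable.ae_notMem volume]
    with l hl hlN hlN' hlJ
  rw [enorm_sq_div_mul_enorm_sq (hpos l ⟨hlJ, hlN⟩),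
    enorm_sq_div_mul_enorm_sq (hpos' l ⟨hlJ, hlN'⟩)]
  have := hl hlJ
  gcongr

theorem evolutionNorm_dualEmbedding_le {𝓗 X : Type*} [NormedAddCommGroup 𝓗]
    [InnerProductSpace ℂ 𝓗] [CompleteSpace 𝓗] [NormedAddCommGroup X] [InnerProductSpace ℂ X]
    [CompleteSpace X] {E E' : SpectralMeasure 𝓗} {ι : X →L[ℂ] 𝓗} {J : Set ℝ} (hJ : IsOpen J)
    {A A' : ℝ → X →L[ℂ] (X →L⋆[ℂ] ℂ)} {σ a σ' a' : ℝ → ℝ} (hA : IsSpectralDensity E ι J A)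
    (hA' : IsSpectralDensity E' ι J A') (hσ : IsAdmissible J σ a) (hσ' : IsAdmissible J σ' a')
    (f : X) (h : ∀ᵐ l : ℝ, l ∈ J →
      |σ' l| / √|deriv a' l| * ‖A' l f‖ ≤ |σ l| / √|deriv a l| * ‖A l f‖) :
    E'.evolutionNorm σ' a' J (dualEmbedding ι) (ι f) ≤
      E.evolutionNorm σ a J (dualEmbedding ι) (ι f) := by
  refine (ENNReal.pow_right_strictMono two_ne_zero).le_iff_le.1 ?_
  rw [hA.evolutionNorm_dualEmbedding_sq hJ hσ, hA'.evolutionNorm_dualEmbedding_sq hJ hσ']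
  gcongr ENNReal.ofReal (2 * Real.pi) * ?_
  exact lintegral_weight_mono hJ hσ hσ' h

theorem mainTheorem9
    {𝓗 : Type*} [NormedAddCommGroup 𝓗] [InnerProductSpace ℂ 𝓗] [CompleteSpace 𝓗]
    {X : Type*} [NormedAddCommGroup X] [NormedSpace ℂ X]
    (ι : X →L[ℂ] 𝓗) (hι : Function.Injective ι) (hι' : DenseRange ι)
    (H H' : 𝓗 →ₗ.[ℂ] 𝓗) (hH : IsSelfAdjoint H) (hH' : IsSelfAdjoint H')
    (E E' : SpectralMeasure 𝓗) (hE : E.IsSpectralMeasureOf H) (hE' : E'.IsSpectralMeasureOf H')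
    (J : Set ℝ) (hJ : IsOpen J)
    (A A' : ℝ → X →L[ℂ] (X →L⋆[ℂ] ℂ))
    (hA : IsSpectralDensity E ι J A) (hA' : IsSpectralDensity E' ι J A')
    (σ a σ' a' : ℝ → ℝ) (hσ : IsAdmissible J σ a) (hσ' : IsAdmissible J σ' a') :
    -- space-local comparison
    (∀ φ ψ : X,
      (∀ᵐ l : ℝ, l ∈ J →
        |σ' l| / √|deriv a' l| * ‖A' l φ ψ‖ ≤ |σ l| / √|deriv a l| * ‖A l φ ψ‖) →
      E'.evolutionNorm σ' a' J (fun u => inner ℂ (ι ψ) u) (ι φ) ≤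
        E.evolutionNorm σ a J (fun u => inner ℂ (ι ψ) u) (ι φ)) ∧
    -- space-global comparison, for a Hilbert space `X`
    (CompleteSpace X → InnerProductSpaceable X → ∀ φ : X,
      (∀ᵐ l : ℝ, l ∈ J →
        |σ' l| / √|deriv a' l| * ‖A' l φ‖ ≤ |σ l| / √|deriv a l| * ‖A l φ‖) →
      E'.evolutionNorm σ' a' J (dualEmbedding ι) (ι φ) ≤
        E.evolutionNorm σ a J (dualEmbedding ι) (ι φ))
 := by
  refine ⟨fun φ ψ h => ?_, fun hc hp φ h => ?_⟩
  · refine (ENNReal.pow_right_strictMono two_ne_zero).le_iff_le.1 ?_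
    rw [hA.evolutionNorm_inner_sq hJ hσ, hA'.evolutionNorm_inner_sq hJ hσ']
    gcongr ENNReal.ofReal (2 * Real.pi) * ?_
    exact lintegral_weight_mono hJ hσ hσ' h
  -- Jordan–von Neumann: the parallelogram law provides an inner product inducing the given norm, so
  -- `ι`, `A` and the dual norm are unchanged.
  · exact @evolutionNorm_dualEmbedding_le 𝓗 X _ _ _ _
      (InnerProductSpace.ofNorm ℂ hp.parallelogram_identity) hc E E' ι J hJ A A' σ a σ' a'
      hA hA' hσ hσ' φ h
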